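/- Let $N\ge 2$ be an integer and let $t>N$ be real. Then there exists a constant $c>0$, depending only on $N$ and $t$, with the following property. Let $p>1$ and $2<q<2p$ be such that $$s:=\frac{2qN(p-1)}{N(2p-q)+2q(p-1)}$$ satisfies $1<s<N$. Put $s^*:=\frac{Ns}{N-s}$, $$\beta:=1-\frac2q+\Big(1-\frac st\Big)\frac{s^*}{s}\,\frac{2p-q}{pq},\qquad \theta:=\frac12\left(\frac1p+\sqrt{\frac1{p^2}+4\beta}\right),$$ and let $\xi,\eta>0$ satisfy $\frac{\xi}{p}+\eta=\theta\xi$ and $\beta\xi=\theta\eta$. Let $\Omega\subset\mathbb R^N$ be a bounded open set, let $u\in W^{1,t}(\Omega)$ have weak gradient $\nabla u$, and let $x_0\in\mathbb R^N$, $r>0$ with $B(x_0,r)\subset\Omega$. Then $$\sup_{B(x_0,\frac r2)}u\;\le\;\inf_{B(x_0,r)}u\;+\;c\,r^{\left(\frac{\xi}{\eta}+\frac N2\right)(\theta-1)}\left(\int_{B(x_0,r)}|\nabla u|^t\,dx\right)^{\frac{\xi}{\eta}\frac{p-1}{tp}}\left(\int_{B(x_0,r)}|\nabla u|^2\,dx\right)^{\frac{\xi(\theta-1)}{2\eta}},$$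 where $B(x,\rho)$ is the open Euclidean ball of centre $x$ and radius $\rho$, and $\sup$ and $\inf$ are the essential supremum and infimum (in particular both are finite). -/

import Mathlib

open MeasureTheory
open scoped ContDiff

noncomputable section

namespace SobolevHarnack

/-- `G` is the weak (distributional) gradient of `u` on the open set `Ω ⊆ ℝᴺ`: both are locally
integrable on `Ω`, and `∫_Ω u ∂_v φ = - ∫_Ω (G · v) φ` for every test function `φ ∈ C_c^∞(Ω)` and
every direction `v`. -/
structure IsWeakGradient {N : ℕ} (Ω : Set (EuclideanSpace ℝ (Fin N)))
    (u : EuclideanSpace ℝ (Fin N) → ℝ)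
    (G : EuclideanSpace ℝ (Fin N) → EuclideanSpace ℝ (Fin N)) : Prop where
  locallyIntegrableOn : LocallyIntegrableOn u Ω volume
  locallyIntegrableOn_grad : LocallyIntegrableOn G Ω volume
  integral_eq : ∀ φ : EuclideanSpace ℝ (Fin N) → ℝ,
    ContDiff ℝ ∞ φ → HasCompactSupport φ → tsupport φ ⊆ Ω →
    ∀ v : EuclideanSpace ℝ (Fin N),
      ∫ x in Ω, u x * fderiv ℝ φ x v = -∫ x in Ω, inner ℝ (G x) v * φ x

/-- `u ∈ W^{1,t}(Ω)`: `u ∈ L^t(Ω)`, and `u` has a weak gradient on `Ω` which is in `L^t(Ω)`. -/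
def MemW1 {N : ℕ} (t : ℝ) (Ω : Set (EuclideanSpace ℝ (Fin N)))
    (u : EuclideanSpace ℝ (Fin N) → ℝ) : Prop :=
  MemLp u (ENNReal.ofReal t) (volume.restrict Ω) ∧
    ∃ G : EuclideanSpace ℝ (Fin N) → EuclideanSpace ℝ (Fin N),
      IsWeakGradient Ω u G ∧ MemLp G (ENNReal.ofReal t) (volume.restrict Ω)

/-- The critical Sobolev exponent `s* = N s / (N - s)` (used for `1 < s < N`). -/
def critExp (N : ℕ) (s : ℝ) : ℝ := N * s / (N - s)

/-- The exponent `s = 2 q N (p - 1) / (N (2 p - q) + 2 q (p - 1))`. -/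
def sExp (N : ℕ) (p q : ℝ) : ℝ :=
  2 * q * N * (p - 1) / (N * (2 * p - q) + 2 * q * (p - 1))

/-- The exponent `β = 1 - 2 / q + (1 - s / t) (s* / s) (2 p - q) / (p q)`. -/
def betaExp (N : ℕ) (t p q : ℝ) : ℝ :=
  1 - 2 / q + (1 - sExp N p q / t) * (critExp N (sExp N p q) / sExp N p q) *
    ((2 * p - q) / (p * q))

/-- The exponent `θ = (1 / p + √(1 / p² + 4 β)) / 2`, the positive root of `θ² - θ / p - β = 0`. -/
def thetaExp (N : ℕ) (t p q : ℝ) : ℝ :=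
  (1 / p + √(1 / p ^ 2 + 4 * betaExp N t p q)) / 2

/-- Essential supremum over `A` of a real function, in the extended reals. -/
def esupOn {N : ℕ} (A : Set (EuclideanSpace ℝ (Fin N)))
    (u : EuclideanSpace ℝ (Fin N) → ℝ) : EReal :=
  essSup (fun x => (u x : EReal)) (volume.restrict A)

/-- Essential infimum over `A` of a real function, in the extended reals. -/
def einfOn {N : ℕ} (A : Set (EuclideanSpace ℝ (Fin N)))
    (u : EuclideanSpace ℝ (Fin N) → ℝ) : EReal :=
  essInf (fun x => (u x : EReal)) (volume.restrict A)

end SobolevHarnack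

end

/-! The estimate is Morrey's inequality on a ball for one exponent `m > N`, with the `L^m` norm of
the gradient interpolated between `L^t` and `L^2`. The algebra behind it is that `β` is independent
of `q` (`betaExp_eq`): with `μ = 1 - 1/p` and `d = 2(1/N - 1/t)` one has `β = μ(1 + d)`, so the
quadratic for `θ` factors as `(θ - 1)(θ + μ) = μd`. The relation between `ξ` and `η` gives `ξ/η =
1/(θ - 1 + μ)`, so `a = μξ/η` and `b = (θ - 1)ξ/η` are nonnegative weights of sum one, and the
exponents of the two integrals are `a/t` and `b/2`.

The constant must not depend on `p` and `q`. Since `θ - 1 < μd` (`thetaExp_bounds`), `b ≤ d/(1 +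
d)`, hence `a/t + b/2` stays below a number `m⁻¹ < 1/N` fixed by `N` and `t`. The slack in Hölder's
inequality becomes a power of the volume of the ball, which supplies the remaining power of `r`.

Morrey's inequality is proved for `C¹` functions and passed to weak gradients by mollification
(`IsWeakGradient.exists_ae_enorm_sub_le`). -/

noncomputable section

namespace SobolevHarnack

/-! ### Morrey's inequality for `C¹` functions. -/

section Morrey

/-- The fundamental theorem of calculus along a segment, as an inequality. -/
theorem enorm_sub_le_lintegral_fderiv {E : Type*} [NormedAddCommGroup E] [NormedSpace ℝ E]
    {f : E → ℝ} (hf : ContDiff ℝ 1 f) (x y : E) :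
    ‖f y - f x‖ₑ
      ≤ ‖y - x‖ₑ * ∫⁻ s in Set.Ioc (0 : ℝ) 1, ‖fderiv ℝ f (x + s • (y - x))‖ₑ := by
  have hd : ∀ s : ℝ, HasDerivAt (fun s : ℝ => f (x + s • (y - x)))
      (fderiv ℝ f (x + s • (y - x)) (y - x)) s := by
    intro s
    have h1 : HasDerivAt (fun s : ℝ => x + s • (y - x)) (y - x) s := by
      simpa using ((hasDerivAt_id s).smul_const (y - x)).const_add x
    exact ((hf.differentiable one_ne_zero _).hasFDerivAt.comp_hasDerivAt s h1)
  have hcont : Continuous fun s : ℝ => fderiv ℝ f (x + s • (y - x)) :=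
    (hf.continuous_fderiv one_ne_zero).comp (by fun_prop)
  have hcont' : Continuous fun s : ℝ => fderiv ℝ f (x + s • (y - x)) (y - x) :=
    hcont.clm_apply continuous_const
  have h := intervalIntegral.integral_eq_sub_of_hasDerivAt (a := 0) (b := 1)
    (fun s _ => hd s) (hcont'.intervalIntegrable _ _)
  have h' : f y - f x = ∫ s in Set.Ioc (0 : ℝ) 1, fderiv ℝ f (x + s • (y - x)) (y - x) := by
    rw [← intervalIntegral.integral_of_le zero_le_one, h]; simp
  rw [h', ← lintegral_const_mul _ hcont.enorm.measurable]
  refine (enorm_integral_le_lintegral_enorm _).trans (lintegral_mono fun s => ?_)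
  rw [mul_comm]
  exact ContinuousLinearMap.le_opENorm _ _

variable {E : Type*} [NormedAddCommGroup E] [NormedSpace ℝ E] [FiniteDimensional ℝ E]
  [MeasurableSpace E] [BorelSpace E] (μ : Measure E) [μ.IsAddHaarMeasure]

/-- Change of variables under a homothety of ratio `s > 0`. -/
theorem lintegral_comp_homothety {h : E → ENNReal} (hh : Measurable h) (x : E) {s : ℝ}
    (hs : 0 < s) :
    ∫⁻ y, h (x + s • (y - x)) ∂μ
      = ENNReal.ofReal ((s ^ Module.finrank ℝ E)⁻¹) * ∫⁻ y, h y ∂μ := by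
  have h1 : ∫⁻ y, h (x + s • (y - x)) ∂μ = ∫⁻ y, h (x + s • y) ∂μ :=
    lintegral_sub_right_eq_self (fun y => h (x + s • y)) x
  have h2 : ∫⁻ y, h (x + s • y) ∂μ = ∫⁻ y, h (x + y) ∂(Measure.map (fun y => s • y) μ) := by
    rw [lintegral_map (f := fun y => h (x + y)) (hh.comp (measurable_const_add x))
      (measurable_const_smul s)]
  rw [h1, h2, Measure.map_addHaar_smul μ hs.ne', lintegral_smul_measure,
    lintegral_add_left_eq_self h x, abs_of_pos (by positivity), smul_eq_mul]

/-- Pulling back by the homothety of centre `x` and ratio `s` costs at most a factor `s⁻ⁿ` for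
integrals over a convex set containing `x`. -/
theorem setLIntegral_comp_homothety_le {B : Set E} (hB : MeasurableSet B) (hc : Convex ℝ B)
    {h : E → ENNReal} (hh : Measurable h) {x : E} (hx : x ∈ B) {s : ℝ} (hs : 0 < s)
    (hs1 : s ≤ 1) :
    ∫⁻ y in B, h (x + s • (y - x)) ∂μ
      ≤ ENNReal.ofReal ((s ^ Module.finrank ℝ E)⁻¹) * ∫⁻ y in B, h y ∂μ := by
  rw [← lintegral_indicator hB h, ← lintegral_comp_homothety μ (hh.indicator hB) x hs,
    ← lintegral_indicator hB]
  refine lintegral_mono fun y => ?_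
  by_cases hy : y ∈ B
  · have : x + s • (y - x) ∈ B := hc.add_smul_sub_mem hx hy ⟨hs.le, hs1⟩
    simp [hy, this]
  · simp [hy]

/-- Used with `a = n / m`, `n` the dimension: this is where Morrey's inequality needs `m > n`. -/
theorem lintegral_Ioc_rpow_neg {a : ℝ} (ha : a < 1) :
    ∫⁻ s in Set.Ioc (0 : ℝ) 1, ENNReal.ofReal (s ^ (-a)) = ENNReal.ofReal ((1 - a)⁻¹) := by
  have hi : IntegrableOn (fun s : ℝ => s ^ (-a)) (Set.Ioc 0 1) := by
    rw [← intervalIntegrable_iff_integrableOn_Ioc_of_le zero_le_one]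
    exact intervalIntegral.intervalIntegrable_rpow' (by linarith)
  rw [← ofReal_integral_eq_lintegral_ofReal hi, ← intervalIntegral.integral_of_le zero_le_one,
    integral_rpow (Or.inl (by linarith))]
  · have h : -a + 1 ≠ 0 := by linarith
    rw [Real.zero_rpow h, Real.one_rpow]
    congr 1
    rw [sub_zero, one_div, neg_add_eq_sub]
  · filter_upwards [ae_restrict_mem measurableSet_Ioc] with s hs
    exact Real.rpow_nonneg hs.1.le _

/-- Hölder's inequality against the constant function `1` on a set. -/
theorem setLIntegral_le_measure_rpow_mul {α : Type*} [MeasurableSpace α] (ν : Measure α)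
    (B : Set α) {F : α → ENNReal} (hF : Measurable F) {m : ℝ} (hm : 1 < m) :
    ∫⁻ y in B, F y ∂ν ≤ ν B ^ (1 - m⁻¹) * (∫⁻ y in B, F y ^ m ∂ν) ^ m⁻¹ := by
  have hm0 : 0 < m := by linarith
  have h := ENNReal.lintegral_mul_norm_pow_le (μ := ν.restrict B) (f := fun _ => 1)
    (g := fun y => F y ^ m) aemeasurable_const (hF.pow_const m).aemeasurable
    (p := 1 - m⁻¹) (q := m⁻¹) (sub_nonneg.2 (inv_le_one_of_one_le₀ hm.le))
    (inv_nonneg.2 hm0.le) (by ring)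
  simpa [← ENNReal.rpow_mul, mul_inv_cancel₀ hm0.ne'] using h

/-- **Morrey's estimate**, averaged form: a continuously differentiable function deviates in mean
from its value at a point of a ball by at most the `L^m` norm of its derivative, `m > dim E`. -/
theorem lintegral_ball_enorm_sub_le {f : E → ℝ} (hf : ContDiff ℝ 1 f) {m : ℝ} (hm1 : 1 < m)
    (hm : (Module.finrank ℝ E : ℝ) < m) (x₀ : E) {r : ℝ} (x : E)
    (hx : x ∈ Metric.ball x₀ r) :
    ∫⁻ y in Metric.ball x₀ r, ‖f y - f x‖ₑ ∂μ
      ≤ ENNReal.ofReal (2 * r) * (ENNReal.ofReal ((1 - Module.finrank ℝ E / m)⁻¹) *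
        (μ (Metric.ball x₀ r) ^ (1 - m⁻¹) *
          (∫⁻ y in Metric.ball x₀ r, ‖fderiv ℝ f y‖ₑ ^ m ∂μ) ^ m⁻¹)) := by
  set B := Metric.ball x₀ r with hB
  have hm0 : 0 < m := by linarith
  have hF : Continuous fun y => ‖fderiv ℝ f y‖ₑ := (hf.continuous_fderiv one_ne_zero).enorm
  have hF2 : Continuous fun z : E × ℝ => ‖fderiv ℝ f (x + z.2 • (z.1 - x))‖ₑ :=
    hF.comp (by fun_prop)
  calc ∫⁻ y in B, ‖f y - f x‖ₑ ∂μ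
      ≤ ∫⁻ y in B, (ENNReal.ofReal (2 * r) *
          ∫⁻ s in Set.Ioc (0 : ℝ) 1, ‖fderiv ℝ f (x + s • (y - x))‖ₑ) ∂μ := by
        refine setLIntegral_mono' measurableSet_ball fun y hy => ?_
        refine (enorm_sub_le_lintegral_fderiv hf x y).trans ?_
        gcongr
        rw [← ofReal_norm]
        apply ENNReal.ofReal_le_ofReal
        rw [← dist_eq_norm]
        have h1 := dist_triangle_right y x x₀
        rw [hB, Metric.mem_ball] at hx hy
        linarith
    _ = ENNReal.ofReal (2 * r) *
          ∫⁻ s in Set.Ioc (0 : ℝ) 1, ∫⁻ y in B, ‖fderiv ℝ f (x + s • (y - x))‖ₑ ∂μ := by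
        rw [lintegral_const_mul, lintegral_lintegral_swap]
        · exact hF2.measurable.aemeasurable
        · exact hF2.measurable.lintegral_prod_right
    -- Hölder at fixed `s`, then the homothety, whose Jacobian `s⁻ⁿ` enters to the power `1/m`.
    _ ≤ ENNReal.ofReal (2 * r) * ∫⁻ s in Set.Ioc (0 : ℝ) 1,
          ENNReal.ofReal (s ^ (-(Module.finrank ℝ E / m : ℝ))) * (μ B ^ (1 - m⁻¹) *
          (∫⁻ y in B, ‖fderiv ℝ f y‖ₑ ^ m ∂μ) ^ m⁻¹) := by
        gcongr ENNReal.ofReal (2 * r) * ?_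
        refine setLIntegral_mono' measurableSet_Ioc fun s hs => ?_
        have hFs : Continuous fun y => ‖fderiv ℝ f (x + s • (y - x))‖ₑ := hF.comp (by fun_prop)
        refine (setLIntegral_le_measure_rpow_mul μ B hFs.measurable hm1).trans ?_
        rw [mul_left_comm]
        gcongr _ * ?_
        have h := setLIntegral_comp_homothety_le μ (h := fun y => ‖fderiv ℝ f y‖ₑ ^ m)
          measurableSet_ball (convex_ball x₀ r) (hF.measurable.pow_const m) hx hs.1 hs.2
        refine (ENNReal.rpow_le_rpow h (inv_nonneg.2 hm0.le)).trans (le_of_eq ?_)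
        rw [ENNReal.mul_rpow_of_nonneg _ _ (inv_nonneg.2 hm0.le)]
        congr 1
        rw [ENNReal.ofReal_rpow_of_nonneg (inv_nonneg.2 (pow_nonneg hs.1.le _))
          (inv_nonneg.2 hm0.le), ← Real.rpow_natCast, ← Real.rpow_neg hs.1.le,
          ← Real.rpow_mul hs.1.le]
        congr 2
        ring
    _ = _ := by
        rw [lintegral_mul_const _ (by fun_prop), lintegral_Ioc_rpow_neg ((div_lt_one hm0).2 hm)]

/-- **Morrey's inequality** on a ball for continuously differentiable functions. -/
theorem enorm_sub_le_of_mem_ball {f : E → ℝ} (hf : ContDiff ℝ 1 f) {m : ℝ} (hm1 : 1 < m)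
    (hm : (Module.finrank ℝ E : ℝ) < m) (x₀ : E) {r : ℝ} (x x' : E)
    (hx : x ∈ Metric.ball x₀ r) (hx' : x' ∈ Metric.ball x₀ r) :
    ‖f x - f x'‖ₑ ≤ ENNReal.ofReal (4 * r * (1 - Module.finrank ℝ E / m)⁻¹) *
        (μ (Metric.ball x₀ r) ^ (-m⁻¹) *
          (∫⁻ y in Metric.ball x₀ r, ‖fderiv ℝ f y‖ₑ ^ m ∂μ) ^ m⁻¹) := by
  set B := Metric.ball x₀ r with hB
  have hr : 0 < r := dist_nonneg.trans_lt hx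
  have hB0 : μ B ≠ 0 := (Metric.measure_ball_pos μ x₀ hr).ne'
  have hBt : μ B ≠ ⊤ := measure_ball_lt_top.ne
  have hcf := hf.continuous
  -- Compare both values with `f y` and integrate over `y` in the ball; dividing by `μ B` then gives
  -- the pointwise bound.
  have h : ‖f x - f x'‖ₑ * μ B ≤ 2 * (ENNReal.ofReal (2 * r) *
      (ENNReal.ofReal ((1 - Module.finrank ℝ E / m)⁻¹) * (μ B ^ (1 - m⁻¹) *
          (∫⁻ y in B, ‖fderiv ℝ f y‖ₑ ^ m ∂μ) ^ m⁻¹))) := by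
    rw [two_mul]
    refine le_trans ?_ (add_le_add (lintegral_ball_enorm_sub_le μ hf hm1 hm x₀ x hx)
      (lintegral_ball_enorm_sub_le μ hf hm1 hm x₀ x' hx'))
    rw [← lintegral_add_left (by fun_prop), ← setLIntegral_const]
    refine lintegral_mono fun y => ?_
    have : f x - f x' = -(f y - f x) + (f y - f x') := by ring
    rw [this]
    exact (enorm_add_le _ _).trans (by rw [enorm_neg])
  have h2 := ENNReal.le_div_iff_mul_le (Or.inl hB0) (Or.inl hBt) |>.2 h
  refine h2.trans (le_of_eq ?_)
  have hc : ENNReal.ofReal (4 * r * (1 - Module.finrank ℝ E / m)⁻¹)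
      = 2 * (ENNReal.ofReal (2 * r) * ENNReal.ofReal ((1 - Module.finrank ℝ E / m)⁻¹)) := by
    rw [← ENNReal.ofReal_mul (by positivity), ← ENNReal.ofReal_ofNat 2,
      ← ENNReal.ofReal_mul zero_le_two]
    congr 1
    ring
  rw [hc, div_eq_mul_inv, sub_eq_add_neg 1 m⁻¹, ENNReal.rpow_add _ _ hB0 hBt, ENNReal.rpow_one]
  calc _ = 2 * (ENNReal.ofReal (2 * r) * ENNReal.ofReal ((1 - Module.finrank ℝ E / m)⁻¹)) *
        (μ B ^ (-m⁻¹) * (∫⁻ y in B, ‖fderiv ℝ f y‖ₑ ^ m ∂μ) ^ m⁻¹) * (μ B * (μ B)⁻¹) := by ring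
    _ = _ := by rw [ENNReal.mul_inv_cancel hB0 hBt, mul_one]

/-- Morrey's inequality on a ball, with explicit dependence on the radius. -/
theorem enorm_sub_le_rpow_of_mem_ball [Nontrivial E] {f : E → ℝ} (hf : ContDiff ℝ 1 f) {m : ℝ}
    (hm1 : 1 < m) (hm : (Module.finrank ℝ E : ℝ) < m) (x₀ : E) {r : ℝ} (x x' : E)
    (hx : x ∈ Metric.ball x₀ r) (hx' : x' ∈ Metric.ball x₀ r) :
    ‖f x - f x'‖ₑ ≤
      ENNReal.ofReal (4 * (1 - Module.finrank ℝ E / m)⁻¹ * r ^ (1 - Module.finrank ℝ E / m)) *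
        (μ (Metric.ball 0 1) ^ (-m⁻¹) *
          (∫⁻ y in Metric.ball x₀ r, ‖fderiv ℝ f y‖ₑ ^ m ∂μ) ^ m⁻¹) := by
  have hr : 0 < r := dist_nonneg.trans_lt hx
  have hm0 : 0 < m := by linarith
  refine (enorm_sub_le_of_mem_ball μ hf hm1 hm x₀ x x' hx hx').trans (le_of_eq ?_)
  rw [← mul_assoc, ← mul_assoc]
  congr 1
  have hrN : (0 : ℝ) < r ^ Module.finrank ℝ E := by positivity
  rw [Measure.addHaar_ball μ x₀ hr.le, ENNReal.mul_rpow_of_ne_zero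
    (by simpa using hrN) (Metric.measure_ball_pos μ 0 one_pos).ne', ← mul_assoc]
  congr 1
  have h1 : 0 < 1 - Module.finrank ℝ E / m := sub_pos.2 ((div_lt_one hm0).2 hm)
  rw [ENNReal.ofReal_rpow_of_pos hrN, ← ENNReal.ofReal_mul (by positivity)]
  congr 1
  rw [← Real.rpow_natCast, ← Real.rpow_mul hr.le, sub_eq_add_neg 1 (_ / m), Real.rpow_add hr,
    Real.rpow_one, mul_neg, ← div_eq_mul_inv (Module.finrank ℝ E : ℝ)]
  ring

end Morrey

/-! ### Averaging kernels on `L^m`. -/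

section Mollification

/-- Jensen's inequality for an averaging kernel. -/
theorem lintegral_mul_rpow_le {α : Type*} [MeasurableSpace α] {ν : Measure α}
    {k g : α → ENNReal} (hk : AEMeasurable k ν) (hk1 : ∫⁻ y, k y ∂ν = 1)
    (hg : AEMeasurable g ν) {m : ℝ} (hm : 1 ≤ m) :
    (∫⁻ y, k y * g y ∂ν) ^ m ≤ ∫⁻ y, k y * g y ^ m ∂ν := by
  have hm0 : 0 < m := by linarith
  have hq : 0 ≤ 1 - m⁻¹ := sub_nonneg.2 (inv_le_one_of_one_le₀ hm)
  -- Hölder after splitting `k g = k^(1 - 1/m) · (k g^m)^(1/m)`; the first factor integrates to one.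
  have h := ENNReal.lintegral_mul_norm_pow_le (f := k) (g := fun y => k y * g y ^ m) hk
    (hk.mul (hg.pow_const m)) hq (inv_nonneg.2 hm0.le) (by ring)
  have he : ∀ y, k y ^ (1 - m⁻¹) * (k y * g y ^ m) ^ m⁻¹ = k y * g y := by
    intro y
    rw [ENNReal.mul_rpow_of_nonneg _ _ (inv_nonneg.2 hm0.le), ← mul_assoc,
      ← ENNReal.rpow_add_of_nonneg _ _ hq (inv_nonneg.2 hm0.le), ← ENNReal.rpow_mul,
      mul_inv_cancel₀ hm0.ne', sub_add_cancel, ENNReal.rpow_one, ENNReal.rpow_one]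
  simp only [he, hk1, ENNReal.one_rpow, one_mul] at h
  calc _ ≤ ((∫⁻ y, k y * g y ^ m ∂ν) ^ m⁻¹) ^ m := ENNReal.rpow_le_rpow h hm0.le
    _ = _ := by rw [← ENNReal.rpow_mul, inv_mul_cancel₀ hm0.ne', ENNReal.rpow_one]

/-- Young's inequality for the convolution with a kernel of total mass one. -/
theorem lintegral_lintegral_sub_mul_rpow_le {E : Type*} [AddCommGroup E] [MeasurableSpace E]
    [MeasurableAdd₂ E] [MeasurableNeg E] {μ : Measure E} [SFinite μ] [μ.IsAddLeftInvariant]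
    [μ.IsNegInvariant] {k g : E → ENNReal} (hk : Measurable k) (hk1 : ∫⁻ y, k y ∂μ = 1)
    (hg : AEMeasurable g μ) {m : ℝ} (hm : 1 ≤ m) :
    ∫⁻ x, (∫⁻ y, k (x - y) * g y ∂μ) ^ m ∂μ ≤ ∫⁻ y, g y ^ m ∂μ := by
  calc ∫⁻ x, (∫⁻ y, k (x - y) * g y ∂μ) ^ m ∂μ
      ≤ ∫⁻ x, ∫⁻ y, k (x - y) * g y ^ m ∂μ ∂μ := by
        refine lintegral_mono fun x => lintegral_mul_rpow_le ?_ ?_ hg hm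
        · exact (hk.comp (measurable_const.sub measurable_id)).aemeasurable
        · rw [lintegral_sub_left_eq_self k x, hk1]
    _ = ∫⁻ y, ∫⁻ x, k (x - y) * g y ^ m ∂μ ∂μ := by
        refine lintegral_lintegral_swap (AEMeasurable.mul ?_ ?_)
        · exact (hk.comp (measurable_fst.sub measurable_snd)).aemeasurable
        · exact (hg.pow_const m).comp_quasiMeasurePreserving
            Measure.quasiMeasurePreserving_snd
    _ = _ := by
        refine lintegral_congr fun y => ?_
        rw [lintegral_mul_const _ (f := fun x => k (x - y))
            (hk.comp (measurable_id.sub measurable_const)),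
          lintegral_sub_right_eq_self k y, hk1, one_mul]

end Mollification

/-! ### Weak gradients: restriction, uniqueness, mollification. -/

section WeakGradient

variable {N : ℕ} {Ω B : Set (EuclideanSpace ℝ (Fin N))} {u : EuclideanSpace ℝ (Fin N) → ℝ}
  {G G' : EuclideanSpace ℝ (Fin N) → EuclideanSpace ℝ (Fin N)}

/-- The weak gradient identity integrated over the whole space. -/
theorem IsWeakGradient.integral_univ_eq (h : IsWeakGradient Ω u G)
    {φ : EuclideanSpace ℝ (Fin N) → ℝ} (hφ : ContDiff ℝ ∞ φ) (hc : HasCompactSupport φ)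
    (hs : tsupport φ ⊆ Ω) (v : EuclideanSpace ℝ (Fin N)) :
    ∫ x, u x * fderiv ℝ φ x v = -∫ x, inner ℝ (G x) v * φ x := by
  rw [← setIntegral_eq_integral_of_forall_compl_eq_zero (s := Ω),
    ← setIntegral_eq_integral_of_forall_compl_eq_zero (s := Ω)
      (f := fun x => inner ℝ (G x) v * φ x)]
  · exact h.integral_eq φ hφ hc hs v
  · intro x hx
    rw [image_eq_zero_of_notMem_tsupport fun h => hx (hs h), mul_zero]
  · intro x hx
    rw [fderiv_of_notMem_tsupport (𝕜 := ℝ) fun h => hx (hs h)]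
    simp

theorem IsWeakGradient.mono (h : IsWeakGradient Ω u G) (hB : B ⊆ Ω) : IsWeakGradient B u G where
  locallyIntegrableOn := h.locallyIntegrableOn.mono_set hB
  locallyIntegrableOn_grad := h.locallyIntegrableOn_grad.mono_set hB
  integral_eq φ hφ hc hs v := by
    rw [setIntegral_eq_integral_of_forall_compl_eq_zero (s := B),
      setIntegral_eq_integral_of_forall_compl_eq_zero (s := B)
        (f := fun x => inner ℝ (G x) v * φ x)]
    · exact h.integral_univ_eq hφ hc (hs.trans hB) v
    · intro x hx
      rw [image_eq_zero_of_notMem_tsupport fun h => hx (hs h), mul_zero]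
    · intro x hx
      rw [fderiv_of_notMem_tsupport (𝕜 := ℝ) fun h => hx (hs h)]
      simp

/-- A locally integrable field times a test function is integrable. -/
theorem integrable_smul_of_locallyIntegrableOn
    (hG : LocallyIntegrableOn G Ω volume)
    {φ : EuclideanSpace ℝ (Fin N) → ℝ} (hφ : Continuous φ) (hc : HasCompactSupport φ)
    (hs : tsupport φ ⊆ Ω) : Integrable fun x => φ x • G x := by
  have h1 : IntegrableOn G (tsupport φ) := hG.integrableOn_compact_subset hs hc
  have h2 : IntegrableOn (fun x => φ x • G x) (tsupport φ) :=
    h1.continuousOn_smul hφ.continuousOn hc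
  rwa [integrableOn_iff_integrable_of_support_subset] at h2
  intro x hx
  exact subset_tsupport φ (fun h => hx (by simp [h]))

/-- Weak gradients are unique up to null sets. -/
theorem IsWeakGradient.ae_eq (hΩ : IsOpen Ω) (h : IsWeakGradient Ω u G)
    (h' : IsWeakGradient Ω u G') : G =ᵐ[volume.restrict Ω] G' := by
  have key : ∀ᵐ x, x ∈ Ω → (G - G') x = 0 := by
    refine hΩ.ae_eq_zero_of_integral_contDiff_smul_eq_zero
      (h.locallyIntegrableOn_grad.sub h'.locallyIntegrableOn_grad) fun φ hφ hc hs => ?_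
    have i1 := integrable_smul_of_locallyIntegrableOn h.locallyIntegrableOn_grad
      hφ.continuous hc hs
    have i2 := integrable_smul_of_locallyIntegrableOn h'.locallyIntegrableOn_grad
      hφ.continuous hc hs
    have e : ∫ x, φ x • (G - G') x = (∫ x, φ x • G x) - ∫ x, φ x • G' x := by
      rw [← integral_sub i1 i2]
      simp [smul_sub]
    rw [e, sub_eq_zero]
    refine ext_inner_left ℝ fun v => ?_
    rw [← integral_inner i1, ← integral_inner i2]
    have := (h.integral_univ_eq hφ hc hs v).symm.trans (h'.integral_univ_eq hφ hc hs v)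
    simpa [inner_smul_right, real_inner_comm v, mul_comm] using this
  rw [Filter.EventuallyEq, ae_restrict_iff' hΩ.measurableSet]
  filter_upwards [key] with x hx hxΩ
  exact sub_eq_zero.1 (hx hxΩ)

open ContinuousLinearMap in
/-- The derivative of a mollification of `u` is bounded by the mollification of the norm of its
weak gradient, at points at distance more than the mollification radius from the boundary. -/
theorem IsWeakGradient.enorm_fderiv_convolution_le (hB : IsOpen B) (h : IsWeakGradient B u G)
    (hu : IntegrableOn u B) (φ : ContDiffBump (0 : EuclideanSpace ℝ (Fin N)))
    {x : EuclideanSpace ℝ (Fin N)} (hx : Metric.closedBall x φ.rOut ⊆ B) :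
    ‖fderiv ℝ (convolution (B.indicator u) (φ.normed volume) (lsmul ℝ ℝ) volume) x‖ₑ
      ≤ ∫⁻ y, ENNReal.ofReal (φ.normed volume (x - y)) * ‖B.indicator G y‖ₑ := by
  set k := φ.normed volume with hk
  have hk_smooth : ContDiff ℝ ∞ k := φ.contDiff_normed
  have hkc : HasCompactSupport k := φ.hasCompactSupport_normed
  have huL : LocallyIntegrable (B.indicator u) volume :=
    (hu.integrable_indicator hB.measurableSet).locallyIntegrable
  have hd := (hkc.hasFDerivAt_convolution_right (lsmul ℝ ℝ) huL
    (hk_smooth.of_le (by simp)) x).fderiv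
  set ψ : EuclideanSpace ℝ (Fin N) → ℝ := fun y => k (x - y) with hψ
  have hψ_smooth : ContDiff ℝ ∞ ψ := hk_smooth.comp (contDiff_const.sub contDiff_id)
  have hψs : tsupport ψ ⊆ Metric.closedBall x φ.rOut := by
    refine closure_minimal (fun y hy => ?_) Metric.isClosed_closedBall
    have h1 : x - y ∈ Function.support k := hy
    rw [hk, φ.support_normed_eq, mem_ball_zero_iff] at h1
    rw [Metric.mem_closedBall, dist_comm, dist_eq_norm]
    exact h1.le
  have hψc : HasCompactSupport ψ :=
    HasCompactSupport.of_support_subset_isCompact (isCompact_closedBall x φ.rOut)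
      ((subset_tsupport ψ).trans hψs)
  have hψd : ∀ y v, fderiv ℝ ψ y v = -fderiv ℝ k (x - y) v := by
    intro y v
    have h1 : HasFDerivAt (fun y => x - y) (-ContinuousLinearMap.id ℝ _) y :=
      (hasFDerivAt_id y).const_sub x
    have h2 := ((hk_smooth.differentiable (by simp)) (x - y)).hasFDerivAt.comp y h1
    have h3 : fderiv ℝ ψ y = _ := h2.fderiv
    rw [h3]
    simp
  have hi := integrable_smul_of_locallyIntegrableOn h.locallyIntegrableOn_grad
    hψ_smooth.continuous hψc (hψs.trans hx)
  have hψ0 : ∀ y, y ∉ B → ψ y = 0 := fun y hy =>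
    image_eq_zero_of_notMem_tsupport fun h => hy (hx (hψs h))
  -- The reflected kernel `ψ` is an admissible test function. The sign from the reflection cancels
  -- the one in the weak gradient identity.
  have hval : ∀ v, fderiv ℝ (convolution (B.indicator u) k (lsmul ℝ ℝ) volume) x v
      = inner ℝ v (∫ y, ψ y • G y) := by
    intro v
    rw [hd, convolution_precompR_apply (lsmul ℝ ℝ) huL (hkc.fderiv (𝕜 := ℝ))
      (hk_smooth.continuous_fderiv (by simp)), convolution_def, ← integral_inner hi]
    have h1 := h.integral_univ_eq hψ_smooth hψc (hψs.trans hx) v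
    have h2 : ∀ y, (lsmul ℝ ℝ (B.indicator u y)) (fderiv ℝ k (x - y) v)
        = -(u y * fderiv ℝ ψ y v) := by
      intro y
      by_cases hy : y ∈ B
      · simp [hy, hψd]
      · have h0 : fderiv ℝ ψ y = 0 := fderiv_of_notMem_tsupport (𝕜 := ℝ) fun h => hy (hx (hψs h))
        simp [hy, h0]
    simp only [h2]
    rw [integral_neg, h1, neg_neg]
    refine integral_congr_ae (Filter.Eventually.of_forall fun y => ?_)
    simp only [inner_smul_right]
    rw [real_inner_comm, mul_comm]
  have hnorm : ‖fderiv ℝ (convolution (B.indicator u) k (lsmul ℝ ℝ) volume) x‖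
      ≤ ‖∫ y, ψ y • G y‖ := by
    refine ContinuousLinearMap.opNorm_le_bound _ (norm_nonneg _) fun v => ?_
    rw [hval v, mul_comm]
    exact norm_inner_le_norm v _
  calc _ ≤ ‖∫ y, ψ y • G y‖ₑ := by
        rw [← ofReal_norm, ← ofReal_norm]
        exact ENNReal.ofReal_le_ofReal hnorm
    _ ≤ ∫⁻ y, ‖ψ y • G y‖ₑ := enorm_integral_le_lintegral_enorm _
    _ = _ := by
        refine lintegral_congr fun y => ?_
        by_cases hy : y ∈ B
        · rw [enorm_smul, Set.indicator_of_mem hy, Real.enorm_of_nonneg (φ.nonneg_normed _)]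
        · simp [hy, hψ0 y hy]

end WeakGradient

/-! ### Morrey's inequality for weak gradients. -/

section WeakMorrey

variable {N : ℕ} {u : EuclideanSpace ℝ (Fin N) → ℝ}
  {G : EuclideanSpace ℝ (Fin N) → EuclideanSpace ℝ (Fin N)}

/-- Mollification does not increase the `L^m` norm of the gradient, up to shrinking the ball. -/
theorem IsWeakGradient.lintegral_enorm_fderiv_convolution_le {x₀ : EuclideanSpace ℝ (Fin N)}
    {r ρ : ℝ} (h : IsWeakGradient (Metric.ball x₀ r) u G)
    (hu : IntegrableOn u (Metric.ball x₀ r))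
    (hG : AEStronglyMeasurable G (volume.restrict (Metric.ball x₀ r)))
    (φ : ContDiffBump (0 : EuclideanSpace ℝ (Fin N))) (hρ : ρ + φ.rOut ≤ r) {m : ℝ}
    (hm : 1 ≤ m) :
    ∫⁻ x in Metric.ball x₀ ρ, ‖fderiv ℝ (convolution ((Metric.ball x₀ r).indicator u)
        (φ.normed volume) (ContinuousLinearMap.lsmul ℝ ℝ) volume) x‖ₑ ^ m
      ≤ ∫⁻ y in Metric.ball x₀ r, ‖G y‖ₑ ^ m := by
  have hm0 : 0 < m := by linarith
  set B := Metric.ball x₀ r with hB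
  calc _ ≤ ∫⁻ x in Metric.ball x₀ ρ,
        (∫⁻ y, ENNReal.ofReal (φ.normed volume (x - y)) * ‖B.indicator G y‖ₑ) ^ m := by
        refine setLIntegral_mono' measurableSet_ball fun x hx => ?_
        refine ENNReal.rpow_le_rpow ?_ hm0.le
        refine h.enorm_fderiv_convolution_le Metric.isOpen_ball hu φ fun y hy => ?_
        rw [Metric.mem_ball] at hx ⊢
        rw [Metric.mem_closedBall] at hy
        linarith [dist_triangle y x x₀]
    _ ≤ ∫⁻ x, (∫⁻ y, ENNReal.ofReal (φ.normed volume (x - y)) * ‖B.indicator G y‖ₑ) ^ m :=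
        setLIntegral_le_lintegral _ _
    _ ≤ ∫⁻ y, ‖B.indicator G y‖ₑ ^ m := by
        refine lintegral_lintegral_sub_mul_rpow_le (k := fun z =>
          ENNReal.ofReal (φ.normed volume z)) ?_ ?_ ?_ hm
        · exact φ.continuous_normed.measurable.ennreal_ofReal
        · rw [← ofReal_integral_eq_lintegral_ofReal φ.integrable_normed
            (Filter.Eventually.of_forall φ.nonneg_normed), φ.integral_normed, ENNReal.ofReal_one]
        · exact ((aestronglyMeasurable_indicator_iff measurableSet_ball).2 hG).enorm
    _ = _ := by
        rw [← lintegral_indicator measurableSet_ball]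
        refine lintegral_congr fun y => ?_
        by_cases hy : y ∈ B
        · simp [hB ▸ hy, hy]
        · simp [hB ▸ hy, hy, hm0]

/-- **Morrey's inequality** for functions with a weak gradient, on a ball: off a null set the
oscillation is controlled by the `L^m` norm of the gradient, `m > N`. -/
theorem IsWeakGradient.exists_ae_enorm_sub_le [Nonempty (Fin N)]
    {x₀ : EuclideanSpace ℝ (Fin N)} {r : ℝ} (h : IsWeakGradient (Metric.ball x₀ r) u G)
    (hu : IntegrableOn u (Metric.ball x₀ r))
    (hG : AEStronglyMeasurable G (volume.restrict (Metric.ball x₀ r))) {m : ℝ} (hm1 : 1 < m)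
    (hm : (N : ℝ) < m) :
    ∃ S : Set (EuclideanSpace ℝ (Fin N)), (∀ᵐ x ∂volume.restrict (Metric.ball x₀ r), x ∈ S) ∧
      ∀ x ∈ S, ∀ x' ∈ S, ‖u x - u x'‖ₑ ≤
        ENNReal.ofReal (4 * (1 - N / m)⁻¹ * r ^ (1 - N / m)) *
          (volume (Metric.ball (0 : EuclideanSpace ℝ (Fin N)) 1) ^ (-m⁻¹) *
            (∫⁻ y in Metric.ball x₀ r, ‖G y‖ₑ ^ m) ^ m⁻¹) := by
  have hm0 : 0 < m := by linarith
  set B := Metric.ball x₀ r with hB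
  have huL : LocallyIntegrable (B.indicator u) volume :=
    (hu.integrable_indicator measurableSet_ball).locallyIntegrable
  have hpos : ∀ k : ℕ, (0 : ℝ) < 1 / ((k : ℝ) + 1) := fun k => by positivity
  -- The fixed ratio `rOut / rIn = 2` is what the almost everywhere convergence of the
  -- mollifications requires.
  let φ : ℕ → ContDiffBump (0 : EuclideanSpace ℝ (Fin N)) := fun k =>
    { rIn := 1 / ((k : ℝ) + 1) / 2
      rOut := 1 / ((k : ℝ) + 1)
      rIn_pos := half_pos (hpos k)
      rIn_lt_rOut := half_lt_self (hpos k) }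
  have hφ : Filter.Tendsto (fun k => (φ k).rOut) Filter.atTop (nhds 0) :=
    tendsto_one_div_add_atTop_nhds_zero_nat
  have hlim := ContDiffBump.ae_convolution_tendsto_right_of_locallyIntegrable (K := 2) hφ
    (Filter.Eventually.of_forall fun k => (mul_div_cancel₀ _ two_ne_zero).ge) huL
  let w : ℕ → EuclideanSpace ℝ (Fin N) → ℝ := fun k =>
    convolution (B.indicator u) ((φ k).normed volume) (ContinuousLinearMap.lsmul ℝ ℝ) volume
  have hw : ∀ k x, convolution ((φ k).normed volume) (B.indicator u)
      (ContinuousLinearMap.lsmul ℝ ℝ) volume x = w k x := by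
    intro k x
    rw [convolution_lsmul_swap]
    refine integral_congr_ae (Filter.Eventually.of_forall fun y => ?_)
    simp [mul_comm]
  have hw_smooth : ∀ k, ContDiff ℝ 1 (w k) := fun k =>
    (φ k).hasCompactSupport_normed.contDiff_convolution_right (n := 1) _ huL
      (φ k).contDiff_normed
  simp only [hw] at hlim
  refine ⟨{x | x ∈ B ∧ Filter.Tendsto (fun k => w k x) Filter.atTop (nhds (u x))}, ?_, ?_⟩
  · filter_upwards [ae_restrict_of_ae hlim, ae_restrict_mem measurableSet_ball] with x hx hxB
    rw [Set.indicator_of_mem (hB ▸ hxB)] at hx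
    exact ⟨hxB, hx⟩
  · rintro x ⟨hxB, hx⟩ x' ⟨hxB', hx'⟩
    -- The mollified gradient is controlled only away from the boundary, so Morrey is applied on a
    -- smaller ball still containing both points.
    obtain ⟨ρ, hρ, hρr⟩ : ∃ ρ, max (dist x x₀) (dist x' x₀) < ρ ∧ ρ < r :=
      exists_between (max_lt hxB hxB')
    have hρ0 : 0 < ρ := (dist_nonneg.trans (le_max_left _ _)).trans_lt hρ
    refine le_of_tendsto (hx.sub hx').enorm ?_
    filter_upwards [hφ.eventually (gt_mem_nhds (sub_pos.2 hρr))] with k hk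
    have hM := enorm_sub_le_rpow_of_mem_ball volume (hw_smooth k) hm1
      (by simpa using hm) x₀ (r := ρ) x x' ((le_max_left _ _).trans_lt hρ)
      ((le_max_right _ _).trans_lt hρ)
    rw [finrank_euclideanSpace_fin] at hM
    refine hM.trans ?_
    have hpos' : 0 < 1 - N / m := sub_pos.2 ((div_lt_one hm0).2 hm)
    have hint := h.lintegral_enorm_fderiv_convolution_le hu hG (φ k) (ρ := ρ) (by linarith) hm1.le
    refine mul_le_mul' (ENNReal.ofReal_le_ofReal (by gcongr)) ?_
    gcongr _ * ?_
    exact ENNReal.rpow_le_rpow hint (inv_nonneg.2 hm0.le)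

end WeakMorrey

/-! ### From pointwise differences to essential bounds. -/

section Oscillation

variable {N : ℕ}

/-- A function whose values on a set of full measure differ by at most `K` has essential
oscillation at most `K`. -/
theorem esupOn_le_einfOn_add {A B S : Set (EuclideanSpace ℝ (Fin N))} (hAB : A ⊆ B)
    {u : EuclideanSpace ℝ (Fin N) → ℝ} (hS : ∀ᵐ x ∂volume.restrict B, x ∈ S) {K : ℝ}
    (hK : ∀ x ∈ S, ∀ x' ∈ S, |u x - u x'| ≤ K) :
    esupOn A u ≤ einfOn B u + (K : EReal) := by
  rw [← EReal.sub_le_iff_le_add (Or.inl (EReal.coe_ne_bot K)) (Or.inl (EReal.coe_ne_top K))]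
  refine le_essInf_of_ae_le _ ?_
  filter_upwards [hS] with x hx
  rw [EReal.sub_le_iff_le_add (Or.inl (EReal.coe_ne_bot K)) (Or.inl (EReal.coe_ne_top K))]
  refine essSup_le_of_ae_le _ ?_
  filter_upwards [ae_mono (Measure.restrict_mono hAB le_rfl) hS] with y hy
  rw [← EReal.coe_add, EReal.coe_le_coe_iff]
  linarith [le_abs_self (u y - u x), hK y hy x hx]

end Oscillation

/-! ### Interpolation between `L^t` and `L^2`. -/

section Holder

/-- Interpolation of `L^m` between `L^t` and `L^2` on a set of finite measure. -/
theorem lintegral_rpow_interpolation {α : Type*} [MeasurableSpace α] (ν : Measure α)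
    {g : α → ENNReal} (hg : AEMeasurable g ν) {a b t m : ℝ} (ha : 0 ≤ a) (hb : 0 ≤ b)
    (hab : a + b = 1) (ht : 0 < t) (hm : 0 < m) (h : a / t + b / 2 ≤ m⁻¹) :
    (∫⁻ x, g x ^ m ∂ν) ^ m⁻¹ ≤ (∫⁻ x, g x ^ t ∂ν) ^ (a / t) *
      (∫⁻ x, g x ^ (2 : ℝ) ∂ν) ^ (b / 2) * ν Set.univ ^ (m⁻¹ - (a / t + b / 2)) := by
  have hc : 0 ≤ m * (m⁻¹ - (a / t + b / 2)) := mul_nonneg hm.le (sub_nonneg.2 h)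
  have hmm : m * m⁻¹ = 1 := mul_inv_cancel₀ hm.ne'
  -- Three-factor Hölder: the constant `1` takes up the slack between `a/t + b/2` and `m⁻¹`.
  have key := ENNReal.lintegral_prod_norm_pow_le (μ := ν) (Finset.univ : Finset (Fin 3))
    (f := ![fun x => g x ^ t, fun x => g x ^ (2 : ℝ), fun _ => 1])
    (by
      intro i _
      fin_cases i
      · exact hg.pow_const t
      · exact hg.pow_const 2
      · exact aemeasurable_const)
    (p := ![m * (a / t), m * (b / 2), m * (m⁻¹ - (a / t + b / 2))])
    (by
      simp only [Fin.sum_univ_three, Matrix.cons_val_zero, Matrix.cons_val_one,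
        Matrix.cons_val_two, Matrix.head_cons, Matrix.tail_cons]
      linear_combination hmm)
    (by
      intro i _
      fin_cases i
      · exact mul_nonneg hm.le (div_nonneg ha ht.le)
      · exact mul_nonneg hm.le (div_nonneg hb zero_le_two)
      · exact hc)
  have e : ∀ x, (g x ^ t) ^ (m * (a / t)) * (g x ^ (2 : ℝ)) ^ (m * (b / 2)) = g x ^ m := by
    intro x
    rw [← ENNReal.rpow_mul, ← ENNReal.rpow_mul,
      ← ENNReal.rpow_add_of_nonneg _ _ (by positivity) (by positivity)]
    congr 1
    field_simp
    exact hab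
  simp only [Fin.prod_univ_three, Matrix.cons_val_zero, Matrix.cons_val_one,
    Matrix.cons_val, ENNReal.one_rpow, mul_one, e, lintegral_one] at key
  refine (ENNReal.rpow_le_rpow key (inv_nonneg.2 hm.le)).trans (le_of_eq ?_)
  rw [ENNReal.mul_rpow_of_nonneg _ _ (inv_nonneg.2 hm.le),
    ENNReal.mul_rpow_of_nonneg _ _ (inv_nonneg.2 hm.le), ← ENNReal.rpow_mul, ← ENNReal.rpow_mul,
    ← ENNReal.rpow_mul]
  have e2 : ∀ z, m * z * m⁻¹ = z := fun z => by rw [mul_right_comm, hmm, one_mul]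
  rw [e2, e2, e2]

end Holder

/-! ### Algebra of `β` and `θ`. -/

section Exponents

/-- The exponent `β` does not depend on `q`. -/
theorem betaExp_eq {N : ℕ} (hN : 2 ≤ N) {t p q : ℝ} (ht : (N : ℝ) < t) (hp : 1 < p)
    (hq : 2 < q) (hqp : q < 2 * p) :
    betaExp N t p q = (1 - 1 / p) * (1 + 2 * (1 / N - 1 / t)) := by
  have hN' : (2 : ℝ) ≤ N := by exact_mod_cast hN
  have hN0 : (N : ℝ) ≠ 0 := by linarith
  have ht0 : t ≠ 0 := by linarith
  have hp0 : p ≠ 0 := by linarith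
  have hq0 : q ≠ 0 := by linarith
  have hp1 : p - 1 ≠ 0 := by linarith
  have hpq : 2 * p - q ≠ 0 := by linarith
  have hD : (N : ℝ) * (2 * p - q) + 2 * q * (p - 1) ≠ 0 := by
    have h1 : 0 < (N : ℝ) * (2 * p - q) := mul_pos (by linarith) (by linarith)
    have h2 : 0 < 2 * q * (p - 1) := mul_pos (by linarith) (by linarith)
    linarith
  have hs : sExp N p q ≠ 0 := by
    unfold sExp
    exact div_ne_zero (mul_ne_zero (mul_ne_zero (by simpa using hq0) hN0) hp1) hD
  -- `N - s` carries the factor `2p - q`, which cancels the same factor in `β`.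
  have hNs : (N : ℝ) - sExp N p q = N ^ 2 * (2 * p - q)
      / (N * (2 * p - q) + 2 * q * (p - 1)) := by
    unfold sExp
    field_simp
    ring
  have hcrit : critExp N (sExp N p q) / sExp N p q
      = (N * (2 * p - q) + 2 * q * (p - 1)) / (N * (2 * p - q)) := by
    unfold critExp
    rw [hNs]
    field_simp
  unfold betaExp
  rw [hcrit]
  unfold sExp
  field_simp
  ring

/-- Replaces the square root by a polynomial identity in all later computations. -/
theorem thetaExp_sq_sub {N : ℕ} {t p q : ℝ} (h : 0 ≤ betaExp N t p q) :
    thetaExp N t p q ^ 2 - thetaExp N t p q / p = betaExp N t p q := by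
  have h1 : √(1 / p ^ 2 + 4 * betaExp N t p q) ^ 2 = 1 / p ^ 2 + 4 * betaExp N t p q :=
    Real.sq_sqrt (by positivity)
  unfold thetaExp
  linear_combination h1 / 4

/-- `θ - 1` is positive and smaller than `2 (1 / N - 1 / t) (1 - 1 / p)`. -/
theorem thetaExp_bounds {N : ℕ} (hN : 2 ≤ N) {t p q : ℝ} (ht : (N : ℝ) < t) (hp : 1 < p)
    (hq : 2 < q) (hqp : q < 2 * p) :
    1 < thetaExp N t p q ∧
      (thetaExp N t p q - 1) * (thetaExp N t p q + (1 - 1 / p))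
        = (1 - 1 / p) * (2 * (1 / N - 1 / t)) ∧
      thetaExp N t p q - 1 < (1 - 1 / p) * (2 * (1 / N - 1 / t)) := by
  have hN' : (2 : ℝ) ≤ N := by exact_mod_cast hN
  have hμ : 0 < 1 - 1 / p := by rw [sub_pos, div_lt_one (by linarith)]; exact hp
  have hδ : 0 < 1 / (N : ℝ) - 1 / t := sub_pos.2 (one_div_lt_one_div_of_lt (by linarith) ht)
  have hβ := betaExp_eq hN ht hp hq hqp
  have hβ0 : 0 ≤ betaExp N t p q := by rw [hβ]; positivity
  have hθ := thetaExp_sq_sub hβ0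
  have hθ0 : 0 ≤ thetaExp N t p q := by
    unfold thetaExp
    have : 0 < p := by linarith
    positivity
  have he : (thetaExp N t p q - 1) * (thetaExp N t p q + (1 - 1 / p))
      = (1 - 1 / p) * (2 * (1 / N - 1 / t)) := by
    linear_combination hθ + hβ
  have h1 : 1 < thetaExp N t p q := by
    have : 0 < thetaExp N t p q - 1 :=
      pos_of_mul_pos_left (he.symm ▸ mul_pos hμ (mul_pos two_pos hδ)) (by positivity)
    linarith
  refine ⟨h1, he, ?_⟩
  -- The strict bound holds because `θ + (1 - 1/p) > 1`.
  rw [← he]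
  nlinarith

end Exponents

/-! ### The interpolated oscillation bound. -/

section Interpolation

/-- The integral of `‖G‖ ^ s` as a lower Lebesgue integral. -/
theorem lintegral_enorm_rpow_eq_ofReal {α F : Type*} [MeasurableSpace α] {ν : Measure α}
    [NormedAddCommGroup F] {G : α → F} {s : ℝ} (hs : 0 < s) (hG : MemLp G (ENNReal.ofReal s) ν) :
    ∫⁻ x, ‖G x‖ₑ ^ s ∂ν = ENNReal.ofReal (∫ x, ‖G x‖ ^ s ∂ν) := by
  have hi := hG.integrable_norm_rpow (by simpa using hs) ENNReal.ofReal_ne_top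
  rw [ENNReal.toReal_ofReal hs.le] at hi
  rw [ofReal_integral_eq_lintegral_ofReal hi
    (Filter.Eventually.of_forall fun x => Real.rpow_nonneg (norm_nonneg _) _)]
  refine lintegral_congr fun x => ?_
  rw [← ofReal_norm, ENNReal.ofReal_rpow_of_nonneg (norm_nonneg _) hs.le]

/-- Removes the dependence of the constant on the exponent of the unit ball volume, which varies
with `a` and `b`. -/
theorem rpow_le_max_one {x y : ℝ} (hx : 0 < x) (hy : 0 ≤ y) (hy1 : y ≤ 1) :
    x ^ y ≤ max 1 x := by
  rcases le_total x 1 with h | h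
  · exact (Real.rpow_le_one hx.le h hy).trans (le_max_left _ _)
  · exact (Real.rpow_le_rpow_of_exponent_le h hy1).trans
      ((Real.rpow_one x).le.trans (le_max_right _ _))

/-- The volume of the unit ball of `ℝᴺ`. -/
def unitBallVol (N : ℕ) : ℝ :=
  (volume (Metric.ball (0 : EuclideanSpace ℝ (Fin N)) 1)).toReal

theorem unitBallVol_pos (N : ℕ) : 0 < unitBallVol N :=
  ENNReal.toReal_pos (Metric.measure_ball_pos _ _ one_pos).ne' measure_ball_lt_top.ne

theorem ofReal_unitBallVol (N : ℕ) : ENNReal.ofReal (unitBallVol N) =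
    volume (Metric.ball (0 : EuclideanSpace ℝ (Fin N)) 1) :=
  ENNReal.ofReal_toReal measure_ball_lt_top.ne

/-- The constant of the interpolated Morrey inequality. -/
def morreyConst (N : ℕ) (m : ℝ) : ℝ :=
  4 * (1 - N / m)⁻¹ * unitBallVol N ^ (-m⁻¹) * max 1 (unitBallVol N)

theorem morreyConst_pos {N : ℕ} {m : ℝ} (hm0 : 0 < m) (hm : (N : ℝ) < m) :
    0 < morreyConst N m := by
  have h1 : 0 < 1 - N / m := sub_pos.2 ((div_lt_one hm0).2 hm)
  have h2 := unitBallVol_pos N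
  unfold morreyConst
  positivity

/-- Essential oscillation bound by a geometric mean of the `L^t` and `L^2` norms of the gradient,
with a constant uniform in the weights `a`, `b`. -/
theorem IsWeakGradient.esupOn_le_einfOn_add {N : ℕ} (hN : 1 ≤ N)
    {u : EuclideanSpace ℝ (Fin N) → ℝ} {G : EuclideanSpace ℝ (Fin N) → EuclideanSpace ℝ (Fin N)}
    {x₀ : EuclideanSpace ℝ (Fin N)} {r : ℝ} (hr : 0 < r)
    (h : IsWeakGradient (Metric.ball x₀ r) u G) (hu : IntegrableOn u (Metric.ball x₀ r))
    {t : ℝ} (ht : 2 ≤ t)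
    (hG : MemLp G (ENNReal.ofReal t) (volume.restrict (Metric.ball x₀ r)))
    {m : ℝ} (hm1 : 1 < m) (hm : (N : ℝ) < m) {a b : ℝ} (ha : 0 ≤ a) (hb : 0 ≤ b)
    (hab : a + b = 1) (habm : a / t + b / 2 ≤ m⁻¹) :
    esupOn (Metric.ball x₀ (r / 2)) u ≤ einfOn (Metric.ball x₀ r) u +
      ((morreyConst N m * r ^ (1 - N * (a / t + b / 2)) *
        (∫ x in Metric.ball x₀ r, ‖G x‖ ^ t) ^ (a / t) *
        (∫ x in Metric.ball x₀ r, ‖G x‖ ^ (2 : ℝ)) ^ (b / 2) : ℝ) : EReal) := by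
  have hne : Nonempty (Fin N) := ⟨⟨0, hN⟩⟩
  have hm0 : 0 < m := by linarith
  have ht0 : 0 < t := by linarith
  have hfin : IsFiniteMeasure (volume.restrict (Metric.ball x₀ r)) :=
    ⟨by simpa using measure_ball_lt_top⟩
  have hG2 : MemLp G (ENNReal.ofReal 2) (volume.restrict (Metric.ball x₀ r)) :=
    hG.mono_exponent (ENNReal.ofReal_le_ofReal ht)
  obtain ⟨S, hS, hSu⟩ := h.exists_ae_enorm_sub_le hu hG.1 hm1 hm
  refine SobolevHarnack.esupOn_le_einfOn_add (Metric.ball_subset_ball (by linarith)) hS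
    fun x hx x' hx' => ?_
  set It := ∫ x in Metric.ball x₀ r, ‖G x‖ ^ t with hIt
  set I2 := ∫ x in Metric.ball x₀ r, ‖G x‖ ^ (2 : ℝ) with hI2
  have hIt0 : 0 ≤ It := integral_nonneg fun x => Real.rpow_nonneg (norm_nonneg _) _
  have hI20 : 0 ≤ I2 := integral_nonneg fun x => Real.rpow_nonneg (norm_nonneg _) _
  set V := unitBallVol N with hV
  have hV0 : 0 < V := unitBallVol_pos N
  have hd : 0 < 1 - N / m := sub_pos.2 ((div_lt_one hm0).2 hm)
  have he : 0 ≤ m⁻¹ - (a / t + b / 2) := sub_nonneg.2 habm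
  have hsum : 0 ≤ a / t + b / 2 := by positivity
  have he1 : m⁻¹ - (a / t + b / 2) ≤ 1 := by
    have := inv_le_one_of_one_le₀ hm1.le
    linarith
  have hint := lintegral_rpow_interpolation (volume.restrict (Metric.ball x₀ r))
    (g := fun x => ‖G x‖ₑ) hG.1.enorm ha hb hab ht0 hm0 habm
  have hvol : volume.restrict (Metric.ball x₀ r) Set.univ = ENNReal.ofReal (r ^ N * V) := by
    rw [Measure.restrict_apply_univ, Measure.addHaar_ball _ _ hr.le, ← ofReal_unitBallVol,
      finrank_euclideanSpace_fin, ENNReal.ofReal_mul (by positivity)]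
  rw [lintegral_enorm_rpow_eq_ofReal ht0 hG, lintegral_enorm_rpow_eq_ofReal two_pos hG2, hvol,
    ENNReal.ofReal_rpow_of_nonneg hIt0 (by positivity),
    ENNReal.ofReal_rpow_of_nonneg hI20 (by positivity),
    ENNReal.ofReal_rpow_of_nonneg (by positivity) he, ← ENNReal.ofReal_mul (by positivity),
    ← ENNReal.ofReal_mul (by positivity)] at hint
  have hfinal := (hSu x hx x' hx').trans (mul_le_mul_right (mul_le_mul_right hint _) _)
  rw [← ofReal_unitBallVol, ENNReal.ofReal_rpow_of_pos hV0, ← ENNReal.ofReal_mul (by positivity),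
    ← ENNReal.ofReal_mul (by positivity), ← ofReal_norm, Real.norm_eq_abs,
    ENNReal.ofReal_le_ofReal_iff (by positivity)] at hfinal
  refine hfinal.trans ?_
  have hpow : r ^ (1 - N / m) * (r ^ N) ^ (m⁻¹ - (a / t + b / 2))
      = r ^ (1 - N * (a / t + b / 2)) := by
    rw [← Real.rpow_natCast, ← Real.rpow_mul hr.le, ← Real.rpow_add hr]
    congr 1
    ring
  rw [Real.mul_rpow (by positivity) hV0.le, ← hpow, morreyConst]
  calc _ = 4 * (1 - N / m)⁻¹ * V ^ (-m⁻¹) * V ^ (m⁻¹ - (a / t + b / 2)) *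
        (r ^ (1 - N / m) * (r ^ N) ^ (m⁻¹ - (a / t + b / 2))) * It ^ (a / t) * I2 ^ (b / 2) := by
        ring
    _ ≤ _ := by
        gcongr
        exact rpow_le_max_one hV0 he he1

end Interpolation

end SobolevHarnack

end

/-! ### The main theorem: matching the exponents. -/

theorem theorem3p2 (N : ℕ) (hN : 2 ≤ N) (t : ℝ) (ht : (N : ℝ) < t) :
    ∃ c : ℝ, 0 < c ∧
      ∀ p q : ℝ, 1 < p → 2 < q → q < 2 * p →
        1 < SobolevHarnack.sExp N p q → SobolevHarnack.sExp N p q < N →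
      ∀ ξ η θ : ℝ, 0 < ξ → 0 < η → θ = SobolevHarnack.thetaExp N t p q →
        ξ / p + η = θ * ξ → SobolevHarnack.betaExp N t p q * ξ = θ * η →
      ∀ Ω : Set (EuclideanSpace ℝ (Fin N)), IsOpen Ω → Bornology.IsBounded Ω →
      ∀ (u : EuclideanSpace ℝ (Fin N) → ℝ)
        (G : EuclideanSpace ℝ (Fin N) → EuclideanSpace ℝ (Fin N)),
        SobolevHarnack.MemW1 t Ω u → SobolevHarnack.IsWeakGradient Ω u G →
      ∀ (x₀ : EuclideanSpace ℝ (Fin N)) (r : ℝ), 0 < r → Metric.ball x₀ r ⊆ Ω →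
        SobolevHarnack.esupOn (Metric.ball x₀ (r / 2)) u ≤
          SobolevHarnack.einfOn (Metric.ball x₀ r) u +
            ((c * r ^ ((ξ / η + (N : ℝ) / 2) * (θ - 1)) *
              (∫ x in Metric.ball x₀ r, ‖G x‖ ^ t) ^ (ξ / η * ((p - 1) / (t * p))) *
              (∫ x in Metric.ball x₀ r, ‖G x‖ ^ (2 : ℝ)) ^ (ξ * (θ - 1) / (2 * η)) : ℝ) :
              EReal) := by
  have hN' : (2 : ℝ) ≤ N := by exact_mod_cast hN
  have hN0 : (0 : ℝ) < N := by linarith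
  have ht0 : 0 < t := by linarith
  obtain ⟨d, hd⟩ : ∃ d : ℝ, d = 2 * (1 / N - 1 / t) := ⟨_, rfl⟩
  have hd0 : 0 < d := by
    rw [hd]
    exact mul_pos two_pos (sub_pos.2 (one_div_lt_one_div_of_lt hN0 ht))
  -- An upper bound for `a/t + b/2` from `a ≤ 1` and `b ≤ d/(1 + d)`. It is below `1/t + d/2 = 1/N`,
  -- so `m > N`.
  obtain ⟨m, hm⟩ : ∃ m : ℝ, m⁻¹ = 1 / t + d / (1 + d) / 2 := ⟨_, inv_inv _⟩
  have hminv0 : 0 < m⁻¹ := by rw [hm]; positivity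
  have hm0 : 0 < m := inv_pos.1 hminv0
  have hNm : (N : ℝ) < m := by
    have h1 : d / (1 + d) < d := div_lt_self hd0 (by linarith)
    have h2 : m⁻¹ < (N : ℝ)⁻¹ := by
      rw [hm, ← one_div]
      linarith
    exact (inv_lt_inv₀ hm0 hN0).1 h2
  refine ⟨SobolevHarnack.morreyConst N m, SobolevHarnack.morreyConst_pos hm0 hNm, ?_⟩
  intro p q hp hq hqp _ _ ξ η θ hξ hη hθ hξη _ Ω hΩ hΩb u G hu hG x₀ r hr hB
  have hp0 : 0 < p := by linarith
  obtain ⟨hθ1, hθe, hθd⟩ := SobolevHarnack.thetaExp_bounds hN ht hp hq hqp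
  rw [← hθ, ← hd] at hθe hθd
  rw [← hθ] at hθ1
  obtain ⟨μ, hμ⟩ : ∃ μ : ℝ, μ = 1 - 1 / p := ⟨_, rfl⟩
  rw [← hμ] at hθe hθd
  have hμ0 : 0 < μ := by
    rw [hμ, sub_pos, div_lt_one hp0]
    exact hp
  have hη' : η = ξ * (θ - 1 + μ) := by
    rw [hμ]
    linear_combination hξη
  have hpos : 0 < θ - 1 + μ := by linarith
  have hξη' : ξ / η = (θ - 1 + μ)⁻¹ := by
    rw [hη']
    field_simp
  have ha : 0 ≤ ξ / η * μ := by positivity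
  have hb : 0 ≤ ξ / η * (θ - 1) := mul_nonneg (by positivity) (by linarith)
  have hab : ξ / η * μ + ξ / η * (θ - 1) = 1 := by
    rw [hξη']
    field_simp
    ring
  -- After cross-multiplication this is `θ - 1 ≤ μd`.
  have hbd : ξ / η * (θ - 1) ≤ d / (1 + d) := by
    rw [hξη', inv_mul_eq_div, div_le_div_iff₀ hpos (by linarith)]
    nlinarith
  have habm : ξ / η * μ / t + ξ / η * (θ - 1) / 2 ≤ m⁻¹ := by
    rw [hm]
    have h1 : ξ / η * μ / t ≤ 1 / t := by
      gcongr
      linarith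
    linarith
  -- Membership in `W^{1,t}` provides some weak gradient in `L^t`; uniqueness transfers the
  -- integrability to `G`.
  obtain ⟨hut, G', hG', hGt'⟩ := hu
  have hGG' := hG.ae_eq hΩ hG'
  have hGt : MemLp G (ENNReal.ofReal t) (volume.restrict Ω) := hGt'.ae_eq hGG'.symm
  have hres := Measure.restrict_mono hB (le_refl (volume : Measure (EuclideanSpace ℝ (Fin N))))
  have hfin : IsFiniteMeasure (volume.restrict Ω) := ⟨by simpa using hΩb.measure_lt_top⟩
  have huB : IntegrableOn u (Metric.ball x₀ r) :=
    (hut.integrable (by simpa using (by linarith : (1 : ℝ) ≤ t))).mono_measure hres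
  have key := (hG.mono hB).esupOn_le_einfOn_add (by omega) hr huB (by linarith)
    (hGt.mono_measure hres) (by linarith : 1 < m) hNm ha hb hab habm
  have e1 : ξ / η * μ / t = ξ / η * ((p - 1) / (t * p)) := by
    rw [hμ]
    field_simp
  have e2 : ξ / η * (θ - 1) / 2 = ξ * (θ - 1) / (2 * η) := by
    field_simp
  -- Once denominators are cleared, the powers of `r` agree by `(θ - 1)(θ + μ) = μd` and the
  -- definition of `d`.
  have e3 : 1 - N * (ξ / η * μ / t + ξ / η * (θ - 1) / 2) = (ξ / η + (N : ℝ) / 2) * (θ - 1) := by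
    have hNd : N * d = 2 - 2 * N / t := by
      rw [hd]
      field_simp
    rw [hξη']
    field_simp
    have hNd' : N * d * t = 2 * t - 2 * N := by
      rw [hNd]
      field_simp
    linear_combination (-N * t) * hθe - μ * hNd'
  rw [e3, e1, e2] at key
  exact key
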